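/- Let $(S,\rho)$ be a complete separable metric space with its Borel $\sigma$-algebra, let $\wp(S)$ be the set of Borel probability measures on $S$, and let $V:S\times S\to[0,\infty)$ be lower semicontinuous. For $\mu_1,\mu_2\in\wp(S)$ let $C(\mu_1,\mu_2)$ be the set of probability measures on $S\times S$ with first marginal $\mu_1$ and second marginal $\mu_2$, and let $$W_V(\mu_1,\mu_2)=\inf_{\xi\in C(\mu_1,\mu_2)}\int_{S\times S}V(s,s')\,d\xi(s,s')\in[0,\infty].$$ Then the following hold. (i) For all $\mu_1,\mu_2\in\wp(S)$ there is $\xi^*\in C(\mu_1,\mu_2)$ with $\int V\,d\xi^*=W_V(\mu_1,\mu_2)$. Moreover, there is a pair of $S$-valued random variables $(s_1,s_2)$ on some probability space, with joint law $\xi^*$, such that $\mathbb E[V(s_1,s_2)]=W_V(\mu_1,\mu_2)$. (ii) If $V$ is positive definite, i.e. $V(s_1,s_2)=0\iff s_1=s_2$, then for all $\mu_1,\mu_2\in\wp(S)$: $W_V(\mu_1,\mu_2)=0$ if and only if $\mu_1=\mu_2$. (iii) If $V$ is symmetric, i.e. $V(s_1,s_2)=V(s_2,s_1)$ for all $s_1,s_2$,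 then $W_V(\mu_1,\mu_2)=W_V(\mu_2,\mu_1)$ for all $\mu_1,\mu_2\in\wp(S)$. (iv) If $V=\rho$, then $W_V$ coincides on $\wp(S)$ with the $1$-Wasserstein distance $W_1$, where $W_p(\mu_1,\mu_2)=\bigl(\inf_{\xi\in C(\mu_1,\mu_2)}\int\rho(s,s')^p\,d\xi\bigr)^{1/p}$. It is an extended metric (a metric that may take the value $\infty$) on $\wp(S)$, and $\wp(S)$ is complete under it. On the set $\mathcal P_1(S)$ of those $\mu\in\wp(S)$ for which $\int\rho(s,s_0)\,\mu(ds)<\infty$ for some $s_0\in S$, it is finite, hence a metric, and $\mathcal P_1(S)$ is complete under it. -/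

import Mathlib

open MeasureTheory
open scoped ENNReal NNReal

universe u

noncomputable section

namespace WassDiv

/-- `couplings μ₁ μ₂` is the set `C(μ₁, μ₂)` of all probability measures on `S × S` whose first
marginal is `μ₁` and whose second marginal is `μ₂`. -/
def couplings {S : Type*} [MeasurableSpace S] (μ₁ μ₂ : ProbabilityMeasure S) :
    Set (ProbabilityMeasure (S × S)) :=
  {ξ | (ξ : Measure (S × S)).fst = (μ₁ : Measure S) ∧
    (ξ : Measure (S × S)).snd = (μ₂ : Measure S)}

/-- The Wasserstein divergence `W_V(μ₁, μ₂) = inf_{ξ ∈ C(μ₁, μ₂)} ∫ V dξ ∈ [0, ∞]` associated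
with a cost `V : S × S → [0, ∞)`. It is defined for all probability measures; the value is `∞`
when every coupling has infinite cost. -/
def wassersteinDiv {S : Type*} [MeasurableSpace S] (V : S × S → ℝ≥0)
    (μ₁ μ₂ : ProbabilityMeasure S) : ℝ≥0∞ :=
  ⨅ ξ ∈ couplings μ₁ μ₂, ∫⁻ z, (V z : ℝ≥0∞) ∂(ξ : Measure (S × S))

/-- Positive definiteness: `V(s₁, s₂) = 0` if and only if `s₁ = s₂`. -/
def IsPosDef {S : Type*} (V : S × S → ℝ≥0) : Prop :=
  ∀ s₁ s₂ : S, V (s₁, s₂) = 0 ↔ s₁ = s₂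

/-- Symmetry: `V(s₁, s₂) = V(s₂, s₁)`. -/
def IsSymmetric {S : Type*} (V : S × S → ℝ≥0) : Prop :=
  ∀ s₁ s₂ : S, V (s₁, s₂) = V (s₂, s₁)

/-- `finiteMoment p S` is the set `P_p(S)` of probability measures on the metric space `S` with
finite moment of order `p`. -/
def finiteMoment (p : ℝ) (S : Type*) [MetricSpace S] [MeasurableSpace S] :
    Set (ProbabilityMeasure S) :=
  {μ | ∃ s₀ : S, ∫⁻ s, edist s s₀ ^ p ∂(μ : Measure S) < ∞}

/-- The usual `p`-Wasserstein distance
`W_p(μ₁, μ₂) = (inf_{ξ ∈ C(μ₁, μ₂)} ∫ ρ(s, s')^p dξ(s, s'))^{1/p}`, with values in `[0, ∞]`. -/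
def wassersteinDist {S : Type*} [MetricSpace S] [MeasurableSpace S] (p : ℝ)
    (μ₁ μ₂ : ProbabilityMeasure S) : ℝ≥0∞ :=
  (⨅ ξ ∈ couplings μ₁ μ₂, ∫⁻ z, edist z.1 z.2 ^ p ∂(ξ : Measure (S × S))) ^ (1 / p)

end WassDiv

end

/-! Couplings of two fixed laws form a weakly compact set: each marginal is tight, hence so are the
couplings (Prokhorov). The cost is weakly lower semicontinuous, so an optimal coupling exists
(`exists_optimal_coupling`), and one of zero cost lives on the diagonal when `V` vanishes only
there.

For the metric cost, gluing two optimal couplings along their common marginal gives the triangle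
inequality. Gluing the optimal couplings of consecutive measures by Ionescu-Tulcea turns a sequence
with summable increments into one random sequence that converges almost surely; the law of its limit
is the limit in `W_1`. Finite distance transfers finite first moments, so the limit stays in
`P_1(S)`. -/

open Filter Topology ProbabilityTheory

namespace WassDiv

/-! ### Weak lower semicontinuity of the cost -/

section LowerSemicontinuity

variable {Ω : Type*} [MeasurableSpace Ω] [TopologicalSpace Ω] [HasOuterApproxClosed Ω]
  [BorelSpace Ω] {f : Ω → ℝ≥0}

/-- Fatou's lemma for weak convergence and a nonnegative lower semicontinuous function. -/
lemma lintegral_le_liminf_of_tendsto (hf : LowerSemicontinuous f)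
    {ξ : ProbabilityMeasure Ω} {ξs : ℕ → ProbabilityMeasure Ω} (h : Tendsto ξs atTop (𝓝 ξ)) :
    ∫⁻ z, (f z : ℝ≥0∞) ∂(ξ : Measure Ω) ≤
      liminf (fun n ↦ ∫⁻ z, (f z : ℝ≥0∞) ∂(ξs n : Measure Ω)) atTop := by
  have hfm : Measurable fun z ↦ (f z : ℝ) := hf.measurable.coe_nnreal_real
  -- Layer cake reduces the claim to superlevel sets of `f`. These are open, so the portmanteau
  -- theorem applies at each level.
  have layer (μ : Measure Ω) :
      ∫⁻ z, (f z : ℝ≥0∞) ∂μ = ∫⁻ t in Set.Ioi (0 : ℝ), μ {z | t < f z} := by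
    rw [← lintegral_eq_lintegral_meas_lt _ (Eventually.of_forall fun z ↦ (f z).coe_nonneg)
      hfm.aemeasurable]
    simp
  have hopen (t : ℝ) (ht : t ∈ Set.Ioi (0 : ℝ)) : IsOpen {z | t < f z} := by
    convert! hf.isOpen_preimage t.toNNReal using 1
    ext z
    simp [Real.toNNReal_lt_iff_lt_coe (le_of_lt ht)]
  simp_rw [layer]
  calc ∫⁻ t in Set.Ioi (0 : ℝ), (ξ : Measure Ω) {z | t < f z}
      ≤ ∫⁻ t in Set.Ioi (0 : ℝ), liminf (fun n ↦ (ξs n : Measure Ω) {z | t < f z}) atTop :=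
        setLIntegral_mono' measurableSet_Ioi fun t ht ↦
          ProbabilityMeasure.le_liminf_measure_open_of_tendsto h (hopen t ht)
    _ ≤ _ := lintegral_liminf_le fun n ↦ Antitone.measurable fun s t hst ↦
        measure_mono fun z hz ↦ lt_of_le_of_lt hst hz

/-- In a first countable space a failure of lower semicontinuity is witnessed by a sequence, so the
sequential inequality suffices. -/
lemma lowerSemicontinuous_lintegral [FirstCountableTopology (ProbabilityMeasure Ω)]
    (hf : LowerSemicontinuous f) :
    LowerSemicontinuous fun ξ : ProbabilityMeasure Ω ↦ ∫⁻ z, (f z : ℝ≥0∞) ∂(ξ : Measure Ω) := by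
  intro ξ c hc
  by_contra hcon
  obtain ⟨ξs, hξs, hle⟩ := exists_seq_forall_of_frequently (not_eventually.1 hcon)
  refine (hc.trans_le (lintegral_le_liminf_of_tendsto hf hξs)).not_ge ?_
  refine (liminf_le_liminf (Eventually.of_forall fun n ↦ not_lt.1 (hle n))).trans ?_
  simp

end LowerSemicontinuity

/-! ### Elementary properties of couplings -/

section Couplings

variable {S : Type*} [MeasurableSpace S] {V : S × S → ℝ≥0} {μ₁ μ₂ : ProbabilityMeasure S}

lemma couplings_nonempty (μ₁ μ₂ : ProbabilityMeasure S) : (couplings μ₁ μ₂).Nonempty :=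
  ⟨μ₁.prod μ₂, by simp [couplings, ProbabilityMeasure.toMeasure_prod]⟩

lemma wassersteinDiv_le {ξ : ProbabilityMeasure (S × S)} (hξ : ξ ∈ couplings μ₁ μ₂) :
    wassersteinDiv V μ₁ μ₂ ≤ ∫⁻ z, (V z : ℝ≥0∞) ∂(ξ : Measure (S × S)) :=
  iInf₂_le ξ hξ

/-- A pair of random variables with laws `μ₁` and `μ₂` bounds the divergence from above. -/
lemma wassersteinDiv_le_lintegral {Ω : Type*} [MeasurableSpace Ω] {P : Measure Ω}
    [IsProbabilityMeasure P] {X Y : Ω → S} (hX : Measurable X) (hY : Measurable Y)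
    (h₁ : P.map X = μ₁) (h₂ : P.map Y = μ₂) (hV : Measurable V) :
    wassersteinDiv V μ₁ μ₂ ≤ ∫⁻ ω, (V (X ω, Y ω) : ℝ≥0∞) ∂P := by
  have hXY : Measurable fun ω ↦ (X ω, Y ω) := hX.prodMk hY
  have hP : IsProbabilityMeasure (P.map fun ω ↦ (X ω, Y ω)) :=
    Measure.isProbabilityMeasure_map hXY.aemeasurable
  refine (wassersteinDiv_le (ξ := ⟨_, hP⟩) ⟨?_, ?_⟩).trans_eq ?_
  · exact (Measure.fst_map_prodMk hY).trans h₁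
  · exact (Measure.snd_map_prodMk hX).trans h₂
  · exact lintegral_map hV.coe_nnreal_ennreal hXY

lemma wassersteinDiv_self (hV : Measurable V) (h : ∀ s, V (s, s) = 0)
    (μ : ProbabilityMeasure S) : wassersteinDiv V μ μ = 0 := by
  have := wassersteinDiv_le_lintegral (P := (μ : Measure S)) (μ₁ := μ) (μ₂ := μ)
    measurable_id measurable_id Measure.map_id Measure.map_id hV
  simpa [h] using this

lemma wassersteinDiv_comm_le (hV : Measurable V) (h : IsSymmetric V)
    (μ₁ μ₂ : ProbabilityMeasure S) : wassersteinDiv V μ₁ μ₂ ≤ wassersteinDiv V μ₂ μ₁ := by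
  refine le_iInf₂ fun ξ hξ ↦ ?_
  refine (wassersteinDiv_le_lintegral measurable_snd measurable_fst hξ.2 hξ.1 hV).trans_eq ?_
  exact lintegral_congr fun z ↦ by rw [h]

lemma wassersteinDiv_comm (hV : Measurable V) (h : IsSymmetric V)
    (μ₁ μ₂ : ProbabilityMeasure S) : wassersteinDiv V μ₁ μ₂ = wassersteinDiv V μ₂ μ₁ :=
  (wassersteinDiv_comm_le hV h μ₁ μ₂).antisymm (wassersteinDiv_comm_le hV h μ₂ μ₁)

/-- Every coupling disintegrates along a Markov kernel. -/
lemma exists_kernel_of_mem_couplings [StandardBorelSpace S] {ξ : ProbabilityMeasure (S × S)}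
    (hξ : ξ ∈ couplings μ₁ μ₂) :
    ∃ κ : Kernel S S, IsMarkovKernel κ ∧ (μ₁ : Measure S) ⊗ₘ κ = ξ := by
  have : Nonempty S := μ₁.nonempty
  refine ⟨(ξ : Measure (S × S)).condKernel, inferInstance, ?_⟩
  rw [← hξ.1, Measure.disintegrate]

end Couplings

/-! ### Compactness, optimal couplings and the triangle inequality -/

section OptimalCoupling

variable {S : Type*} [MetricSpace S] [CompleteSpace S] [TopologicalSpace.SeparableSpace S]
  [MeasurableSpace S] [BorelSpace S] {V : S × S → ℝ≥0}

lemma isCompact_couplings (μ₁ μ₂ : ProbabilityMeasure S) : IsCompact (couplings μ₁ μ₂) := by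
  have : SecondCountableTopology S := UniformSpace.secondCountable_of_separable S
  have hclosed : IsClosed (couplings μ₁ μ₂) := by
    have h₁ := isClosed_singleton (x := μ₁).preimage
      (ProbabilityMeasure.continuous_map (Ω := S × S) continuous_fst)
    have h₂ := isClosed_singleton (x := μ₂).preimage
      (ProbabilityMeasure.continuous_map (Ω := S × S) continuous_snd)
    convert! h₁.inter h₂ using 1
    ext ξ
    simp [couplings, Measure.fst, Measure.snd, ← ProbabilityMeasure.toMeasure_injective.eq_iff]
  have htight : IsTightMeasureSet {(ξ : Measure (S × S)) | ξ ∈ couplings μ₁ μ₂} := by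
    refine IsTightMeasureSet.prodMk
      ((isTightMeasureSet_singleton (μ := (μ₁ : Measure S))).subset ?_)
      ((isTightMeasureSet_singleton (μ := (μ₂ : Measure S))).subset ?_)
    · rintro _ ⟨_, ⟨ξ, hξ, rfl⟩, rfl⟩
      exact hξ.1
    · rintro _ ⟨_, ⟨ξ, hξ, rfl⟩, rfl⟩
      exact hξ.2
  simpa [hclosed.closure_eq] using isCompact_closure_of_isTightMeasureSet htight

theorem exists_optimal_coupling (hV : LowerSemicontinuous V) (μ₁ μ₂ : ProbabilityMeasure S) :
    ∃ ξ ∈ couplings μ₁ μ₂,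
      ∫⁻ z, (V z : ℝ≥0∞) ∂(ξ : Measure (S × S)) = wassersteinDiv V μ₁ μ₂ := by
  have : SecondCountableTopology S := UniformSpace.secondCountable_of_separable S
  obtain ⟨ξ, hξ, hmin⟩ := ((lowerSemicontinuous_lintegral hV).lowerSemicontinuousOn
    (couplings μ₁ μ₂)).exists_isMinOn (couplings_nonempty μ₁ μ₂) (isCompact_couplings μ₁ μ₂)
  exact ⟨ξ, hξ, (le_iInf₂ fun ξ' hξ' ↦ hmin hξ').antisymm (wassersteinDiv_le hξ)⟩

lemma eq_of_wassersteinDiv_eq_zero (hV : LowerSemicontinuous V)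
    (h : ∀ s₁ s₂, V (s₁, s₂) = 0 → s₁ = s₂) {μ₁ μ₂ : ProbabilityMeasure S}
    (h0 : wassersteinDiv V μ₁ μ₂ = 0) : μ₁ = μ₂ := by
  have : SecondCountableTopology S := UniformSpace.secondCountable_of_separable S
  obtain ⟨ξ, hξ, hopt⟩ := exists_optimal_coupling hV μ₁ μ₂
  rw [h0, lintegral_eq_zero_iff hV.measurable.coe_nnreal_ennreal] at hopt
  refine ProbabilityMeasure.toMeasure_injective ?_
  rw [← hξ.1, ← hξ.2, Measure.fst, Measure.snd]
  refine Measure.map_congr ?_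
  filter_upwards [hopt] with z hz
  exact h _ _ (by simpa using hz)

lemma wassersteinDiv_triangle (hV : LowerSemicontinuous V)
    (h : ∀ s₁ s₂ s₃, V (s₁, s₃) ≤ V (s₁, s₂) + V (s₂, s₃)) (μ₁ μ₂ μ₃ : ProbabilityMeasure S) :
    wassersteinDiv V μ₁ μ₃ ≤ wassersteinDiv V μ₁ μ₂ + wassersteinDiv V μ₂ μ₃ := by
  have : SecondCountableTopology S := UniformSpace.secondCountable_of_separable S
  have hVm : Measurable V := hV.measurable
  obtain ⟨ξ, hξ, hξopt⟩ := exists_optimal_coupling hV μ₁ μ₂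
  obtain ⟨η, hη, hηopt⟩ := exists_optimal_coupling hV μ₂ μ₃
  obtain ⟨κ, _, hκ⟩ := exists_kernel_of_mem_couplings hη
  -- The third point is drawn from `κ` given the second alone, hence conditionally independent of
  -- the first.
  set P : Measure ((S × S) × S) := (ξ : Measure (S × S)) ⊗ₘ κ.comap Prod.snd measurable_snd with hP
  have hP₁₂ : P.map Prod.fst = ξ := Measure.fst_compProd _ _
  have hP₂₃ : P.map (fun z ↦ (z.1.2, z.2)) = η := by
    rw [← hκ, ← hξ.2, Measure.snd]
    ext s hs
    rw [Measure.map_apply (by fun_prop) hs, hP, Measure.compProd_apply (hs.preimage (by fun_prop)),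
      Measure.compProd_apply hs, lintegral_map (Kernel.measurable_kernel_prodMk_left hs)
        measurable_snd]
    rfl
  have hP₁ : P.map (fun z ↦ z.1.1) = μ₁ := by
    rw [← hξ.1, ← hP₁₂, Measure.fst, Measure.map_map measurable_fst measurable_fst]
    rfl
  have hP₃ : P.map Prod.snd = μ₃ := by
    rw [← hη.2, ← hP₂₃, Measure.snd, Measure.map_map measurable_snd (by fun_prop)]
    rfl
  rw [← hξopt, ← hηopt, ← hP₁₂, ← hP₂₃,
    lintegral_map hVm.coe_nnreal_ennreal measurable_fst,
    lintegral_map hVm.coe_nnreal_ennreal (by fun_prop), ← lintegral_add_left (by fun_prop)]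
  refine (wassersteinDiv_le_lintegral (by fun_prop) measurable_snd hP₁ hP₃ hVm).trans
    (lintegral_mono fun z ↦ ?_)
  exact (ENNReal.coe_le_coe.2 (h z.1.1 z.1.2 z.2)).trans_eq (ENNReal.coe_add _ _)

end OptimalCoupling

/-! ### Gluing infinitely many couplings -/

section Gluing

variable {S : Type*} [MeasurableSpace S] [StandardBorelSpace S]

/-- A sequence of couplings of consecutive measures is realized by a single random sequence. -/
lemma exists_measure_consecutive_couplings {μ : ℕ → ProbabilityMeasure S}
    {ξ : ℕ → ProbabilityMeasure (S × S)} (hξ : ∀ n, ξ n ∈ couplings (μ n) (μ (n + 1))) :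
    ∃ P : Measure (ℕ → S), IsProbabilityMeasure P ∧ (∀ n, P.map (fun x ↦ x n) = μ n) ∧
      ∀ n, P.map (fun x ↦ (x n, x (n + 1))) = ξ n := by
  choose κ _ hκ using fun n ↦ exists_kernel_of_mem_couplings (hξ n)
  let last (n : ℕ) (x : Finset.Iic n → S) : S := x ⟨n, Finset.mem_Iic.2 le_rfl⟩
  have hlast (n : ℕ) : Measurable (last n) := measurable_pi_apply _
  -- The transition sees only the last state of the history: the glued sequence is a Markov chain.
  let K (n : ℕ) : Kernel (Finset.Iic n → S) S := (κ n).comap (last n) (hlast n)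
  let P : Measure (ℕ → S) := Kernel.trajMeasure (X := fun _ ↦ S) (μ 0 : Measure S) K
  have hstep (n : ℕ) : P.map (fun x ↦ (x n, x (n + 1))) = P.map (fun x ↦ x n) ⊗ₘ κ n := by
    have key := Kernel.map_frestrictLe_trajMeasure_compProd_eq_map_trajMeasure
      (X := fun _ ↦ S) (μ₀ := (μ 0 : Measure S)) (κ := K) (a := n)
    have h₁ : P.map (fun x ↦ (x n, x (n + 1))) =
        (P.map (fun x ↦ (Preorder.frestrictLe n x, x (n + 1)))).map (Prod.map (last n) id) := by
      rw [Measure.map_map (by fun_prop) (by fun_prop)]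
      rfl
    have h₂ : P.map (fun x ↦ x n) = (P.map (Preorder.frestrictLe n)).map (last n) := by
      rw [Measure.map_map (hlast n) (by fun_prop)]
      rfl
    rw [h₁, h₂, ← key]
    ext s hs
    rw [Measure.map_apply (by fun_prop) hs,
      Measure.compProd_apply (hs.preimage (by fun_prop)), Measure.compProd_apply hs,
      lintegral_map (Kernel.measurable_kernel_prodMk_left hs) (hlast n)]
    rfl
  have hmarg (n : ℕ) : P.map (fun x ↦ x n) = μ n := by
    induction n with
    | zero =>
      have h : P.map (fun x ↦ x 0) = (P.map (Preorder.frestrictLe 0)).map (last 0) := by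
        rw [Measure.map_map (hlast 0) (by fun_prop)]
        rfl
      rw [h, show P = Kernel.trajMeasure (X := fun _ ↦ S) (μ 0 : Measure S) K from rfl,
        Kernel.trajMeasure, Measure.map_comp _ _ (by fun_prop), Kernel.traj_map_frestrictLe,
        Kernel.partialTraj_self, Measure.id_comp,
        Measure.map_map (hlast 0) (MeasurableEquiv.measurable _)]
      exact Measure.map_id
    | succ n ih =>
      have h : P.map (fun x ↦ x (n + 1)) = (P.map (fun x ↦ (x n, x (n + 1)))).snd := by
        rw [Measure.snd_map_prodMk (by fun_prop)]
      rw [h, hstep, ih, hκ, (hξ n).2]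
  exact ⟨P, inferInstance, hmarg, fun n ↦ by rw [hstep, hmarg, hκ]⟩

end Gluing

/-! ### The metric cost: convergence and moments -/

section MetricCost

variable {S : Type*} [MetricSpace S]

variable (S) in
/-- The metric of `S` as a cost function. -/
abbrev metricCost : S × S → ℝ≥0 := fun z ↦ nndist z.1 z.2

lemma lowerSemicontinuous_metricCost : LowerSemicontinuous (metricCost S) :=
  (continuous_fst.nndist continuous_snd).lowerSemicontinuous

variable [MeasurableSpace S]

lemma wassersteinDiv_metricCost_eq (μ₁ μ₂ : ProbabilityMeasure S) :
    wassersteinDiv (metricCost S) μ₁ μ₂ = wassersteinDist 1 μ₁ μ₂ := by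
  simp [wassersteinDiv, wassersteinDist]

variable [TopologicalSpace.SeparableSpace S] [BorelSpace S]

lemma wassersteinDiv_ne_top_of_mem_finiteMoment {μ₁ μ₂ : ProbabilityMeasure S}
    (h₁ : μ₁ ∈ finiteMoment 1 S) (h₂ : μ₂ ∈ finiteMoment 1 S) :
    wassersteinDiv (metricCost S) μ₁ μ₂ ≠ ∞ := by
  have : SecondCountableTopology S := UniformSpace.secondCountable_of_separable S
  obtain ⟨a, ha⟩ := h₁
  obtain ⟨b, hb⟩ := h₂
  simp only [ENNReal.rpow_one] at ha hb
  obtain ⟨ξ, hξ⟩ := couplings_nonempty μ₁ μ₂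
  rw [← hξ.1, Measure.fst, lintegral_map (by fun_prop) measurable_fst] at ha
  rw [← hξ.2, Measure.snd, lintegral_map (by fun_prop) measurable_snd] at hb
  refine ne_top_of_le_ne_top ?_ (wassersteinDiv_le hξ)
  have hle : ∫⁻ z, (metricCost S z : ℝ≥0∞) ∂(ξ : Measure (S × S)) ≤
      ∫⁻ z, (edist z.1 a + edist a b + edist z.2 b) ∂(ξ : Measure (S × S)) := by
    refine lintegral_mono fun z ↦ ?_
    rw [← edist_nndist, edist_comm z.2]
    exact edist_triangle4 _ _ _ _
  refine ne_top_of_le_ne_top ?_ hle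
  rw [lintegral_add_left (by fun_prop), lintegral_add_left (by fun_prop)]
  simp [ha.ne, hb.ne, edist_ne_top]

variable [CompleteSpace S]

/-- Almost sure convergence of a random sequence with summable expected increments. -/
lemma exists_tendsto_lintegral_edist {Ω : Type*} [MeasurableSpace Ω] {P : Measure Ω}
    {X : ℕ → Ω → S} (hX : ∀ n, Measurable (X n))
    (hsum : ∑' n, ∫⁻ ω, edist (X n ω) (X (n + 1) ω) ∂P ≠ ∞) :
    ∃ Y : Ω → S, Measurable Y ∧ Tendsto (fun n ↦ ∫⁻ ω, edist (X n ω) (Y ω) ∂P) atTop (𝓝 0) := by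
  have : SecondCountableTopology S := UniformSpace.secondCountable_of_separable S
  have hmeas (n : ℕ) : Measurable fun ω ↦ edist (X n ω) (X (n + 1) ω) := (hX n).edist (hX (n + 1))
  have hfin : ∀ᵐ ω ∂P, ∑' n, edist (X n ω) (X (n + 1) ω) < ∞ := by
    refine ae_lt_top (Measurable.tsum hmeas) ?_
    rwa [lintegral_tsum fun n ↦ (hmeas n).aemeasurable]
  have hlim : ∀ᵐ ω ∂P, ∃ y, Tendsto (fun n ↦ X n ω) atTop (𝓝 y) := by
    filter_upwards [hfin] with ω hω
    exact cauchySeq_tendsto_of_complete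
      (cauchySeq_of_edist_le_of_tsum_ne_top _ (fun n ↦ le_rfl) hω.ne)
  obtain ⟨Y, hY, hYlim⟩ :=
    measurable_limit_of_tendsto_metrizable_ae (fun n ↦ (hX n).aemeasurable) hlim
  -- The distance from `X n` to the limit is at most the tail of the increments from `n` on, whose
  -- expectations are tails of a convergent series.
  refine ⟨Y, hY, tendsto_of_tendsto_of_tendsto_of_le_of_le tendsto_const_nhds
    (ENNReal.tendsto_sum_nat_add _ hsum) (fun n ↦ zero_le) fun n ↦ ?_⟩
  rw [← lintegral_tsum fun k ↦ (hmeas (k + n)).aemeasurable]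
  refine lintegral_mono_ae ?_
  filter_upwards [hYlim] with ω hω
  refine (edist_le_tsum_of_edist_le_of_tendsto _ (fun n ↦ le_rfl) hω n).trans_eq ?_
  exact tsum_congr fun k ↦ by rw [add_comm n k]

theorem exists_tendsto_wassersteinDiv {μ : ℕ → ProbabilityMeasure S}
    (hμ : ∑' n, wassersteinDiv (metricCost S) (μ n) (μ (n + 1)) ≠ ∞) :
    ∃ ν : ProbabilityMeasure S,
      Tendsto (fun n ↦ wassersteinDiv (metricCost S) (μ n) ν) atTop (𝓝 0) := by
  have : SecondCountableTopology S := UniformSpace.secondCountable_of_separable S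
  choose ξ hξ hopt using fun n ↦
    exists_optimal_coupling lowerSemicontinuous_metricCost (μ n) (μ (n + 1))
  obtain ⟨P, _, hP, hPξ⟩ := exists_measure_consecutive_couplings hξ
  have hcost (n : ℕ) : ∫⁻ x, edist (x n) (x (n + 1)) ∂P =
      wassersteinDiv (metricCost S) (μ n) (μ (n + 1)) := by
    rw [← hopt, ← hPξ, lintegral_map
      lowerSemicontinuous_metricCost.measurable.coe_nnreal_ennreal (by fun_prop)]
    simp
  obtain ⟨Y, hY, hlim⟩ := exists_tendsto_lintegral_edist (P := P) (X := fun n x ↦ x n)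
    (fun n ↦ measurable_pi_apply n) (by simpa only [hcost] using hμ)
  refine ⟨⟨P.map Y, Measure.isProbabilityMeasure_map hY.aemeasurable⟩,
    tendsto_of_tendsto_of_tendsto_of_le_of_le tendsto_const_nhds hlim (fun n ↦ zero_le)
      fun n ↦ ?_⟩
  refine (wassersteinDiv_le_lintegral (measurable_pi_apply n) hY (hP n) rfl
    lowerSemicontinuous_metricCost.measurable).trans_eq ?_
  simp

/-- Integrate the triangle inequality through the first coordinate against an optimal coupling. -/
lemma mem_finiteMoment_of_wassersteinDiv_ne_top {μ₁ μ₂ : ProbabilityMeasure S}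
    (h₁ : μ₁ ∈ finiteMoment 1 S) (h : wassersteinDiv (metricCost S) μ₁ μ₂ ≠ ∞) :
    μ₂ ∈ finiteMoment 1 S := by
  have : SecondCountableTopology S := UniformSpace.secondCountable_of_separable S
  obtain ⟨a, ha⟩ := h₁
  obtain ⟨ξ, hξ, hopt⟩ := exists_optimal_coupling lowerSemicontinuous_metricCost μ₁ μ₂
  simp only [ENNReal.rpow_one] at ha
  rw [← hopt] at h
  rw [← hξ.1, Measure.fst, lintegral_map (by fun_prop) measurable_fst] at ha
  refine ⟨a, ?_⟩
  simp only [ENNReal.rpow_one]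
  rw [← hξ.2, Measure.snd, lintegral_map (by fun_prop) measurable_snd]
  have hle : ∫⁻ z, edist z.2 a ∂(ξ : Measure (S × S)) ≤
      ∫⁻ z, (edist z.1 a + (metricCost S z : ℝ≥0∞)) ∂(ξ : Measure (S × S)) := by
    refine lintegral_mono fun z ↦ ?_
    rw [← edist_nndist, add_comm, edist_comm z.1 z.2]
    exact edist_triangle _ _ _
  refine hle.trans_lt ?_
  rw [lintegral_add_left (by fun_prop)]
  exact ENNReal.add_lt_top.2 ⟨ha, h.lt_top⟩

end MetricCost

/-! ### From a distance function to a complete metric -/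

section AbstractMetric

variable {α : Type*} (W : α → α → ℝ≥0∞)

/-- An extended distance function for which sequences with summable increments converge defines
a complete extended metric. -/
lemma exists_emetricSpace_completeSpace (hself : ∀ x, W x x = 0) (hcomm : ∀ x y, W x y = W y x)
    (htri : ∀ x y z, W x z ≤ W x y + W y z) (hsep : ∀ x y, W x y = 0 → x = y)
    (hlim : ∀ u : ℕ → α, ∑' n, W (u n) (u (n + 1)) ≠ ∞ →
      ∃ x, Tendsto (fun n ↦ W (u n) x) atTop (𝓝 0)) :
    ∃ m : EMetricSpace α, (∀ x y, m.edist x y = W x y) ∧ @CompleteSpace α m.toUniformSpace := by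
  let m : EMetricSpace α :=
    { edist := W
      edist_self := hself
      edist_comm := hcomm
      edist_triangle := htri
      eq_of_edist_eq_zero := fun {x y} ↦ hsep x y }
  refine ⟨m, fun _ _ ↦ rfl, ?_⟩
  -- Tolerances `2⁻ⁿ` are summable, so controlled sequences fall under `hlim`.
  refine EMetric.complete_of_convergent_controlled_sequences (fun n ↦ (2⁻¹ : ℝ≥0∞) ^ n)
    (fun n ↦ by simp [ENNReal.pow_pos]) fun u hu ↦ ?_
  obtain ⟨x, hx⟩ := hlim u (ne_top_of_le_ne_top (b := ∑' n, (2⁻¹ : ℝ≥0∞) ^ n) (by simp)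
    (ENNReal.tsum_le_tsum fun n ↦ (hu n n (n + 1) le_rfl n.le_succ).le))
  exact ⟨x, tendsto_iff_edist_tendsto_0.2 hx⟩

lemma exists_metricSpace_completeSpace (hself : ∀ x, W x x = 0) (hcomm : ∀ x y, W x y = W y x)
    (htri : ∀ x y z, W x z ≤ W x y + W y z) (hsep : ∀ x y, W x y = 0 → x = y)
    (hlim : ∀ u : ℕ → α, ∑' n, W (u n) (u (n + 1)) ≠ ∞ →
      ∃ x, Tendsto (fun n ↦ W (u n) x) atTop (𝓝 0))
    (hfin : ∀ x y, W x y ≠ ∞) :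
    ∃ m : MetricSpace α, (∀ x y, ENNReal.ofReal (m.dist x y) = W x y) ∧
      @CompleteSpace α m.toUniformSpace := by
  obtain ⟨m, hm, hcomplete⟩ := exists_emetricSpace_completeSpace W hself hcomm htri hsep hlim
  -- Passing to a finite metric keeps the uniformity, so completeness carries over unchanged.
  refine ⟨EMetricSpace.toMetricSpace fun x y ↦ (hm x y).trans_ne (hfin x y), fun x y ↦ ?_,
    hcomplete⟩
  rw [← hm x y]
  exact ENNReal.ofReal_toReal ((hm x y).trans_ne (hfin x y))

end AbstractMetric

end WassDiv

theorem mainTheorem8 {S : Type u} [MetricSpace S] [CompleteSpace S]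
    [TopologicalSpace.SeparableSpace S] [MeasurableSpace S] [BorelSpace S]
    (V : S × S → ℝ≥0) (hV : LowerSemicontinuous V) :
    -- (i) an optimal coupling exists, and it is the law of a pair of random variables
    (∀ μ₁ μ₂ : ProbabilityMeasure S,
      ∃ ξ ∈ WassDiv.couplings μ₁ μ₂,
        ∫⁻ z, (V z : ℝ≥0∞) ∂(ξ : Measure (S × S)) = WassDiv.wassersteinDiv V μ₁ μ₂ ∧
        ∃ (Ω : Type u) (_ : MeasurableSpace Ω) (P : Measure Ω) (s₁ s₂ : Ω → S),
          IsProbabilityMeasure P ∧ Measurable s₁ ∧ Measurable s₂ ∧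
          P.map (fun ω => (s₁ ω, s₂ ω)) = (ξ : Measure (S × S)) ∧
          ∫⁻ ω, (V (s₁ ω, s₂ ω) : ℝ≥0∞) ∂P = WassDiv.wassersteinDiv V μ₁ μ₂) ∧
    -- (ii) separation of points
    (WassDiv.IsPosDef V → ∀ μ₁ μ₂ : ProbabilityMeasure S,
      (WassDiv.wassersteinDiv V μ₁ μ₂ = 0 ↔ μ₁ = μ₂)) ∧
    -- (iii) symmetry
    (WassDiv.IsSymmetric V → ∀ μ₁ μ₂ : ProbabilityMeasure S,
      WassDiv.wassersteinDiv V μ₁ μ₂ = WassDiv.wassersteinDiv V μ₂ μ₁) ∧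
    -- (iv) the case where `V` is the metric of `S`
    ((∀ s₁ s₂ : S, V (s₁, s₂) = nndist s₁ s₂) →
      -- it coincides with the 1-Wasserstein distance
      (∀ μ₁ μ₂ : ProbabilityMeasure S,
        WassDiv.wassersteinDiv V μ₁ μ₂ = WassDiv.wassersteinDist 1 μ₁ μ₂) ∧
      -- on all probability measures it is a complete extended metric
      (∃ m : EMetricSpace (ProbabilityMeasure S),
        (∀ μ₁ μ₂ : ProbabilityMeasure S, m.edist μ₁ μ₂ = WassDiv.wassersteinDiv V μ₁ μ₂) ∧
        @CompleteSpace (ProbabilityMeasure S) m.toUniformSpace) ∧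
      -- on probability measures with finite first moment it is a (finite) complete metric
      (∃ m : MetricSpace (WassDiv.finiteMoment 1 S),
        (∀ μ₁ μ₂ : WassDiv.finiteMoment 1 S,
          ENNReal.ofReal (m.dist μ₁ μ₂) =
            WassDiv.wassersteinDiv V (μ₁ : ProbabilityMeasure S) (μ₂ : ProbabilityMeasure S)) ∧
        @CompleteSpace (WassDiv.finiteMoment 1 S) m.toUniformSpace)) := by
  have : SecondCountableTopology S := UniformSpace.secondCountable_of_separable S
  refine ⟨fun μ₁ μ₂ ↦ ?_, fun h μ₁ μ₂ ↦ ?_, WassDiv.wassersteinDiv_comm hV.measurable, fun h ↦ ?_⟩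
  · obtain ⟨ξ, hξ, hopt⟩ := WassDiv.exists_optimal_coupling hV μ₁ μ₂
    exact ⟨ξ, hξ, hopt, S × S, inferInstance, ξ, Prod.fst, Prod.snd, inferInstance,
      measurable_fst, measurable_snd, Measure.map_id, hopt⟩
  · refine ⟨WassDiv.eq_of_wassersteinDiv_eq_zero hV fun s₁ s₂ ↦ (h s₁ s₂).1, ?_⟩
    rintro rfl
    exact WassDiv.wassersteinDiv_self hV.measurable (fun s ↦ (h s s).2 rfl) μ₁
  · obtain rfl : V = WassDiv.metricCost S := funext fun z ↦ h z.1 z.2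
    have hself := WassDiv.wassersteinDiv_self (V := WassDiv.metricCost S) hV.measurable (by simp)
    have hcomm := WassDiv.wassersteinDiv_comm (V := WassDiv.metricCost S) hV.measurable
      fun s₁ s₂ ↦ nndist_comm s₁ s₂
    have htri := WassDiv.wassersteinDiv_triangle hV fun s₁ s₂ s₃ ↦ nndist_triangle s₁ s₂ s₃
    have hsep (μ₁ μ₂ : ProbabilityMeasure S) :=
      WassDiv.eq_of_wassersteinDiv_eq_zero (μ₁ := μ₁) (μ₂ := μ₂) hV (by simp)
    refine ⟨WassDiv.wassersteinDiv_metricCost_eq, ?_, ?_⟩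
    · exact WassDiv.exists_emetricSpace_completeSpace _ hself hcomm htri hsep
        fun μ hμ ↦ WassDiv.exists_tendsto_wassersteinDiv hμ
    · refine WassDiv.exists_metricSpace_completeSpace
        (fun μ₁ μ₂ : WassDiv.finiteMoment 1 S ↦ WassDiv.wassersteinDiv (WassDiv.metricCost S)
          (μ₁ : ProbabilityMeasure S) (μ₂ : ProbabilityMeasure S))
        (fun μ ↦ hself μ) (fun μ₁ μ₂ ↦ hcomm μ₁ μ₂) (fun μ₁ μ₂ μ₃ ↦ htri μ₁ μ₂ μ₃)
        (fun μ₁ μ₂ h0 ↦ Subtype.ext (hsep μ₁ μ₂ h0)) (fun μ hμ ↦ ?_)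
        (fun μ₁ μ₂ ↦ WassDiv.wassersteinDiv_ne_top_of_mem_finiteMoment μ₁.2 μ₂.2)
      obtain ⟨ν, hν⟩ := WassDiv.exists_tendsto_wassersteinDiv (μ := fun n ↦ (μ n).1) hμ
      -- A single term at finite distance from `ν` gives `ν` a finite first moment.
      obtain ⟨n, hn⟩ := (hν.eventually (gt_mem_nhds ENNReal.zero_lt_top)).exists
      exact ⟨⟨ν, WassDiv.mem_finiteMoment_of_wassersteinDiv_ne_top (μ n).2 hn.ne⟩, hν⟩
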